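/- Let $D=\{(x,y)\in\mathbb R^2: x^2+y^2<1\}$ with the metric $g_0=\frac{4(dx^2+dy^2)}{(1-x^2-y^2)^2}$ be the hyperbolic plane $H^2(-1)$, and let $B=\{(x,y,z): x^2+y^2+z^2<1\}$ with the metric $h_0=\frac{4(dx^2+dy^2+dz^2)}{(1-x^2-y^2-z^2)^2}$ be hyperbolic 3-space $H^3(-1)$. Let $U\subseteq D$ be a nonempty open set (for instance $U=D$), let $w$ be a positive harmonic function on $U$ (i.e. $w_{xx}+w_{yy}=0$), put $\rho=\sqrt{1-x^2-y^2}$ and $$\beta(x,y,z)=\frac{2\rho^3}{-2\rho z-2(\rho^2-z^2)\arctan\frac{z}{\rho}+w(x,y)\,\rho^3(\rho^2-z^2)},$$ and let $N=\{(x,y,z)\in B:(x,y)\in U,\ \beta(x,y,z)>0\}$. Then $N$ is open, $h=\beta^{-2}h_0$ is a smooth Riemannian metric on $N$, and the map $\varphi:(U,g_0)\to(N,h)$, $\varphi(x,y)=(x,y,0)$, is a conformal immersion with conformal factor $\lambda=\frac{w(x,y)(1-x^2-y^2)}{2}$ (that is, $\varphi^*h=\lambda^2g_0$) which is proper biharmonic: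 its bitension field $$\tau_2(\varphi)=\mathrm{Trace}_{g_0}(\nabla^\varphi\nabla^\varphi-\nabla^\varphi_{\nabla^{g_0}})\tau(\varphi)-\mathrm{Trace}_{g_0}R^{h}(d\varphi,\tau(\varphi))d\varphi$$ vanishes identically on $U$, while its tension field $\tau(\varphi)=\mathrm{Trace}_{g_0}\nabla d\varphi$ does not. Here $R^h(X,Y)Z=\nabla_X\nabla_YZ-\nabla_Y\nabla_XZ-\nabla_{[X,Y]}Z$. -/

import Mathlib

open Matrix
open scoped ContDiff

noncomputable section

/-- Coordinate space `ℝⁿ` with its Euclidean norm. -/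
abbrev Coord (n : ℕ) : Type := EuclideanSpace ℝ (Fin n)

/-- The partial derivative `∂f/∂xᵢ` at `p`. -/
def pderiv {n : ℕ} (i : Fin n) (f : Coord n → ℝ) (p : Coord n) : ℝ :=
  fderiv ℝ f p (EuclideanSpace.single i 1)

/-- The matrix field `g` (the Gram matrices of the coordinate frame) is a smooth Riemannian metric
on the set `U` of coordinate space. -/
structure IsRiemannianMetricOn {n : ℕ} (g : Coord n → Matrix (Fin n) (Fin n) ℝ)
    (U : Set (Coord n)) : Prop where
  smooth : ∀ i j, ContDiffOn ℝ ∞ (fun p => g p i j) U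
  posDef : ∀ p ∈ U, (g p).PosDef

/-- Christoffel symbols `Γᵏᵢⱼ = ½ Σₗ gᵏˡ (∂ᵢ gⱼₗ + ∂ⱼ gᵢₗ - ∂ₗ gᵢⱼ)` of the Levi-Civita connection
of `g`. -/
def christoffel {n : ℕ} (g : Coord n → Matrix (Fin n) (Fin n) ℝ) (k i j : Fin n)
    (p : Coord n) : ℝ :=
  (1 / 2) * ∑ l, (g p)⁻¹ k l *
    (pderiv i (fun q => g q j l) p + pderiv j (fun q => g q i l) p - pderiv l (fun q => g q i j) p)

/-- Components of the Riemann curvature of `g`, with the convention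
`R(X,Y)Z = ∇_X ∇_Y Z - ∇_Y ∇_X Z - ∇_[X,Y] Z`: one has
`R(∂_b, ∂_c) ∂_d = Σₐ (curvature g a b c d) ∂ₐ`. -/
def curvature {n : ℕ} (g : Coord n → Matrix (Fin n) (Fin n) ℝ) (a b c d : Fin n)
    (p : Coord n) : ℝ :=
  pderiv b (christoffel g a c d) p - pderiv c (christoffel g a b d) p
    + ∑ e, (christoffel g a b e p * christoffel g e c d p
      - christoffel g a c e p * christoffel g e b d p)

/-- The pullback `φ^* h`, as a matrix field. -/
def pullbackMetric {m n : ℕ} (h : Coord n → Matrix (Fin n) (Fin n) ℝ) (φ : Coord m → Coord n)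
    (p : Coord m) : Matrix (Fin m) (Fin m) ℝ :=
  Matrix.of fun i j =>
    ∑ a, ∑ b, h (φ p) a b * pderiv i (fun q => φ q a) p * pderiv j (fun q => φ q b) p

/-- The pullback connection `∇^φ`: component `a` of `∇^φ_{∂ᵢ} V`, for a section `V` of the pullback
of the tangent bundle of `(ℝⁿ, h)` under `φ`. -/
def pullbackCovDeriv {m n : ℕ} (h : Coord n → Matrix (Fin n) (Fin n) ℝ) (φ : Coord m → Coord n)
    (V : Coord m → Fin n → ℝ) (i : Fin m) (p : Coord m) (a : Fin n) : ℝ :=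
  pderiv i (fun q => V q a) p
    + ∑ b, ∑ c, christoffel h a b c (φ p) * pderiv i (fun q => φ q b) p * V p c

/-- The tension field `τ(φ) = Trace_g ∇dφ`, where
`(∇dφ)(∂ᵢ, ∂ⱼ) = ∇^φ_{∂ᵢ} (dφ ∂ⱼ) - dφ(∇^M_{∂ᵢ} ∂ⱼ)`. -/
def tensionField {m n : ℕ} (g : Coord m → Matrix (Fin m) (Fin m) ℝ)
    (h : Coord n → Matrix (Fin n) (Fin n) ℝ) (φ : Coord m → Coord n)
    (p : Coord m) (a : Fin n) : ℝ :=
  ∑ i, ∑ j, (g p)⁻¹ i j *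
    (pullbackCovDeriv h φ (fun q b => pderiv j (fun r => φ r b) q) i p a
      - ∑ k, christoffel g k i j p * pderiv k (fun q => φ q a) p)

/-- The bitension field
`τ₂(φ) = Trace_g (∇^φ ∇^φ - ∇^φ_{∇^M}) τ(φ) - Trace_g R^N(dφ, τ(φ)) dφ`. -/
def bitensionField {m n : ℕ} (g : Coord m → Matrix (Fin m) (Fin m) ℝ)
    (h : Coord n → Matrix (Fin n) (Fin n) ℝ) (φ : Coord m → Coord n)
    (p : Coord m) (a : Fin n) : ℝ :=
  (∑ i, ∑ j, (g p)⁻¹ i j *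
    (pullbackCovDeriv h φ (fun q => pullbackCovDeriv h φ (tensionField g h φ) j q) i p a
      - ∑ k, christoffel g k i j p * pullbackCovDeriv h φ (tensionField g h φ) k p a))
  - ∑ i, ∑ j, (g p)⁻¹ i j *
    ∑ b, ∑ c, ∑ d, curvature h a b c d (φ p)
      * pderiv i (fun q => φ q b) p * tensionField g h φ p c * pderiv j (fun q => φ q d) p

/-- `φ : (U, g) → (·, h)` is a harmonic map: its tension field vanishes identically on `U`. -/
def IsHarmonicMapOn {m n : ℕ} (g : Coord m → Matrix (Fin m) (Fin m) ℝ)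
    (h : Coord n → Matrix (Fin n) (Fin n) ℝ) (φ : Coord m → Coord n) (U : Set (Coord m)) : Prop :=
  ∀ p ∈ U, tensionField g h φ p = 0

/-- `φ : (U, g) → (·, h)` is a biharmonic map: its bitension field vanishes identically on `U`. -/
def IsBiharmonicMapOn {m n : ℕ} (g : Coord m → Matrix (Fin m) (Fin m) ℝ)
    (h : Coord n → Matrix (Fin n) (Fin n) ℝ) (φ : Coord m → Coord n) (U : Set (Coord m)) : Prop :=
  ∀ p ∈ U, bitensionField g h φ p = 0

/-- Proper biharmonic: biharmonic and not harmonic. -/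
def IsProperBiharmonicMapOn {m n : ℕ} (g : Coord m → Matrix (Fin m) (Fin m) ℝ)
    (h : Coord n → Matrix (Fin n) (Fin n) ℝ) (φ : Coord m → Coord n) (U : Set (Coord m)) : Prop :=
  IsBiharmonicMapOn g h φ U ∧ ¬ IsHarmonicMapOn g h φ U

/-- `φ : (U, g) → (N, h)` is a smooth conformal immersion with conformal factor `factor > 0`, that
is, `φ^* h = factor² g` on `U`. -/
structure IsConformalImmersionOn {m n : ℕ} (g : Coord m → Matrix (Fin m) (Fin m) ℝ)
    (h : Coord n → Matrix (Fin n) (Fin n) ℝ) (φ : Coord m → Coord n)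
    (U : Set (Coord m)) (N : Set (Coord n)) (factor : Coord m → ℝ) : Prop where
  mapsTo : Set.MapsTo φ U N
  smooth : ContDiffOn ℝ ∞ φ U
  immersion : ∀ p ∈ U, Function.Injective (fderiv ℝ φ p)
  factor_pos : ∀ p ∈ U, 0 < factor p
  conformal : ∀ p ∈ U, pullbackMetric h φ p = factor p ^ 2 • g p

/-- The metric `4 (dx₁² + ⋯ + dxₙ²) / (1 - |x|²)²` of curvature `-1`; hyperbolic space `Hⁿ(-1)` is
the unit ball `Metric.ball 0 1` with this metric. -/
def hyperbolicMetric (n : ℕ) (p : Coord n) : Matrix (Fin n) (Fin n) ℝ :=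
  (4 / (1 - ‖p‖ ^ 2) ^ 2) • (1 : Matrix (Fin n) (Fin n) ℝ)

/-- `ρ = √(1 - x² - y²)`. -/
def rhoFn (x y : ℝ) : ℝ := √(1 - x ^ 2 - y ^ 2)

/-- `β = 2ρ³ / (-2ρz - 2(ρ² - z²) arctan(z/ρ) + w(x,y) ρ³ (ρ² - z²))`. -/
def betaFn (w : Coord 2 → ℝ) (p : Coord 3) : ℝ :=
  2 * rhoFn (p 0) (p 1) ^ 3 /
    (-2 * rhoFn (p 0) (p 1) * p 2
      - 2 * (rhoFn (p 0) (p 1) ^ 2 - p 2 ^ 2) * Real.arctan (p 2 / rhoFn (p 0) (p 1))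
      + w !₂[p 0, p 1] * rhoFn (p 0) (p 1) ^ 3 * (rhoFn (p 0) (p 1) ^ 2 - p 2 ^ 2))

/-- The part of hyperbolic 3-space that lies over `U` (where `w` is given) and on which `β > 0`. -/
def betaDomain (U : Set (Coord 2)) (w : Coord 2 → ℝ) : Set (Coord 3) :=
  {p | p ∈ Metric.ball (0 : Coord 3) 1 ∧ !₂[p 0, p 1] ∈ U ∧ 0 < betaFn w p}

/-- The conformally changed hyperbolic metric `β⁻² h₀`. -/
def conformalHyperbolicMetric (w : Coord 2 → ℝ) (p : Coord 3) : Matrix (Fin 3) (Fin 3) ℝ :=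
  (betaFn w p ^ 2)⁻¹ • hyperbolicMetric 3 p

/-- The inclusion `(x, y) ↦ (x, y, 0)`. -/
def planeInclusion (p : Coord 2) : Coord 3 := !₂[p 0, p 1, 0]

end

/-! Write `β⁻² h₀ = f² (dx² + dy² + dz²)` and `g₀ = u² (dx² + dy²)` with `u = 2 / (1 - x² - y²)`.
The plane `z = 0` is totally umbilical in the first metric, with principal curvature `κ = f_z / f²`
with respect to the unit normal `ν = f⁻¹ ∂_z`, and its tension field from the second is `a ν` with
`a = -2 f_z / u²`. In dimension two the trace Laplacian scales by `u⁻²`, and together with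
Codazzi's equation this gives the bitension field
`u⁻² (2 κ ∇a + (Δa / f - a (Δf + f_zz) / f²) ∂_z)`, where `∇` and `Δ` are those of the flat plane.
So the plane is proper biharmonic as soon as `a` is a nonzero constant and `f` satisfies
`Δf + f_zz = 0` along it. The function `β` is chosen so that `f` restricts to the harmonic function
`w` on the plane, `f_z = -u²` there, and `f - w` is odd in `z`, whence `f_zz = 0`. -/

open Filter Topology InnerProductSpace Laplacian

section PartialDerivatives

variable {n : ℕ} {i j : Fin n} {f g : Coord n → ℝ} {p : Coord n}

theorem pderiv_congr (h : f =ᶠ[𝓝 p] g) : pderiv i f p = pderiv i g p := by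
  rw [pderiv, pderiv, h.fderiv_eq]

theorem pderiv_const (c : ℝ) : pderiv i (fun _ => c) p = 0 := by
  simp [pderiv]

theorem pderiv_add (hf : DifferentiableAt ℝ f p) (hg : DifferentiableAt ℝ g p) :
    pderiv i (fun q => f q + g q) p = pderiv i f p + pderiv i g p := by
  simp [pderiv, fderiv_fun_add hf hg]

theorem pderiv_sub (hf : DifferentiableAt ℝ f p) (hg : DifferentiableAt ℝ g p) :
    pderiv i (fun q => f q - g q) p = pderiv i f p - pderiv i g p := by
  simp [pderiv, fderiv_fun_sub hf hg]

theorem pderiv_mul (hf : DifferentiableAt ℝ f p) (hg : DifferentiableAt ℝ g p) :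
    pderiv i (fun q => f q * g q) p = f p * pderiv i g p + g p * pderiv i f p := by
  simp [pderiv, fderiv_fun_mul hf hg]

theorem pderiv_const_mul (c : ℝ) (hf : DifferentiableAt ℝ f p) :
    pderiv i (fun q => c * f q) p = c * pderiv i f p := by
  simp [pderiv, fderiv_const_mul hf]

theorem hasDerivAt_line {t : ℝ} (hf : DifferentiableAt ℝ f (p + t • EuclideanSpace.single i 1)) :
    HasDerivAt (fun s : ℝ => f (p + s • EuclideanSpace.single i 1))
      (pderiv i f (p + t • EuclideanSpace.single i 1)) t := by
  have hline : HasDerivAt (fun s : ℝ => p + s • EuclideanSpace.single i (1 : ℝ))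
      (EuclideanSpace.single i 1) t := by
    simpa using ((hasDerivAt_id t).smul_const (EuclideanSpace.single i (1 : ℝ))).const_add p
  exact hf.hasFDerivAt.comp_hasDerivAt t hline

theorem hasDerivAt_line_zero (hf : DifferentiableAt ℝ f p) :
    HasDerivAt (fun s : ℝ => f (p + s • EuclideanSpace.single i 1)) (pderiv i f p) 0 :=
  hf.hasFDerivAt.hasLineDerivAt _

theorem differentiableAt_div (hf : DifferentiableAt ℝ f p) (hg : DifferentiableAt ℝ g p)
    (h : g p ≠ 0) : DifferentiableAt ℝ (fun q => f q / g q) p := by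
  simpa only [div_eq_mul_inv] using hf.fun_mul (hg.fun_inv h)

theorem pderiv_div (hf : DifferentiableAt ℝ f p) (hg : DifferentiableAt ℝ g p) (h : g p ≠ 0) :
    pderiv i (fun q => f q / g q) p = (pderiv i f p * g p - f p * pderiv i g p) / g p ^ 2 := by
  have hdiv := (hasDerivAt_line_zero (i := i) hf).fun_div (hasDerivAt_line_zero (i := i) hg)
    (by simpa using h)
  simpa using (hasDerivAt_line_zero (differentiableAt_div hf hg h)).unique hdiv

theorem pderiv_coord (a : Fin n) : pderiv i (fun q => q a) p = if a = i then 1 else 0 := by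
  have h : HasFDerivAt (fun q : Coord n => q a) (EuclideanSpace.proj a : Coord n →L[ℝ] ℝ) p :=
    (EuclideanSpace.proj a : Coord n →L[ℝ] ℝ).hasFDerivAt
  simp [pderiv, h.fderiv]

theorem contDiffAt_pderiv {k : WithTop ℕ∞} (hf : ContDiffAt ℝ (k + 1) f p) :
    ContDiffAt ℝ k (pderiv i f) p :=
  hf.fderiv_right_succ.clm_apply contDiffAt_const

theorem pderiv_pderiv_eq_fderiv_fderiv (hf : ContDiffAt ℝ 2 f p) :
    pderiv i (pderiv j f) p
      = fderiv ℝ (fderiv ℝ f) p (EuclideanSpace.single i 1) (EuclideanSpace.single j 1) := by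
  have hd : DifferentiableAt ℝ (fderiv ℝ f) p :=
    (hf.fderiv_right (m := 1) le_rfl).differentiableAt one_ne_zero
  have h : pderiv j f = fun q => fderiv ℝ f q (EuclideanSpace.single j 1) := rfl
  rw [h, pderiv, fderiv_clm_apply hd (differentiableAt_const _)]
  simp

theorem pderiv_comm (hf : ContDiffAt ℝ 2 f p) :
    pderiv i (pderiv j f) p = pderiv j (pderiv i f) p := by
  rw [pderiv_pderiv_eq_fderiv_fderiv hf, pderiv_pderiv_eq_fderiv_fderiv hf]
  exact hf.isSymmSndFDerivAt (by simp) _ _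

theorem pderiv_pderiv_eq_deriv_deriv_line (hf : ContDiffAt ℝ 2 f p) :
    pderiv i (pderiv i f) p
      = deriv (deriv fun t : ℝ => f (p + t • EuclideanSpace.single i 1)) 0 := by
  have hline : Tendsto (fun t : ℝ => p + t • EuclideanSpace.single i (1 : ℝ)) (𝓝 0) (𝓝 p) := by
    have h : Continuous fun t : ℝ => p + t • EuclideanSpace.single i (1 : ℝ) := by fun_prop
    simpa using h.tendsto 0
  have hderiv : (deriv fun t : ℝ => f (p + t • EuclideanSpace.single i 1))
      =ᶠ[𝓝 0] fun t => pderiv i f (p + t • EuclideanSpace.single i 1) := by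
    filter_upwards [hline.eventually (hf.eventually (by decide))] with t ht
    exact (hasDerivAt_line (ht.differentiableAt two_ne_zero)).deriv
  rw [hderiv.deriv_eq]
  exact (hasDerivAt_line_zero ((contDiffAt_pderiv hf).differentiableAt one_ne_zero)).deriv.symm

theorem pderiv_pderiv_eq_zero_of_odd (hf : ContDiffAt ℝ 2 f p)
    (hodd : ∀ t : ℝ, f (p + t • EuclideanSpace.single i 1) - f p
      = f p - f (p + (-t) • EuclideanSpace.single i 1)) :
    pderiv i (pderiv i f) p = 0 := by
  rw [pderiv_pderiv_eq_deriv_deriv_line hf]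
  set k := fun t : ℝ => f (p + t • EuclideanSpace.single i 1) with hk
  have hrefl : k = fun t => 2 * f p - k (-t) := funext fun t => by
    have := hodd t
    simp only [hk]
    linarith
  have hk₁ : deriv k = fun t => deriv k (-t) := by
    funext t
    conv_lhs => rw [hrefl, deriv_const_sub, deriv_comp_neg, neg_neg]
  have hk₂ : deriv (deriv k) 0 = -deriv (deriv k) 0 := by
    conv_lhs => rw [hk₁, deriv_comp_neg, neg_zero]
  linarith

end PartialDerivatives

section Harmonic

variable {E E' F : Type*} [NormedAddCommGroup E] [InnerProductSpace ℝ E] [FiniteDimensional ℝ E]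
  [NormedAddCommGroup E'] [InnerProductSpace ℝ E'] [FiniteDimensional ℝ E']
  [NormedAddCommGroup F] [NormedSpace ℝ F]

theorem laplacian_comp_linearIsometryEquiv (f : E → F) (L : E' ≃ₗᵢ[ℝ] E) (x : E') :
    Δ (f ∘ L) x = Δ f (L x) := by
  have h : iteratedFDeriv ℝ 2 (f ∘ L) x = (iteratedFDeriv ℝ 2 f (L x)).compContinuousLinearMap
      fun _ => (L.toContinuousLinearEquiv : E' →L[ℝ] E) := by
    have h := L.toContinuousLinearEquiv.iteratedFDerivWithin_comp_right f uniqueDiffOn_univ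
      (Set.mem_univ (L x)) 2
    simp only [iteratedFDerivWithin_univ, Set.preimage_univ] at h
    exact h
  rw [laplacian_eq_iteratedFDeriv_stdOrthonormalBasis,
    laplacian_eq_iteratedFDeriv_orthonormalBasis f ((stdOrthonormalBasis ℝ E').map L)]
  refine Finset.sum_congr rfl fun i _ => ?_
  rw [h, ContinuousMultilinearMap.compContinuousLinearMap_apply]
  congr 1
  ext k
  fin_cases k <;> rfl

theorem harmonicAt_comp_linearIsometryEquiv {f : E → F} (L : E' ≃ₗᵢ[ℝ] E) {x : E'}
    (hf : HarmonicAt f (L x)) : HarmonicAt (f ∘ L) x := by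
  refine ⟨hf.1.comp x L.contDiff.contDiffAt, ?_⟩
  filter_upwards [L.continuous.continuousAt.eventually hf.2] with y hy
  rw [laplacian_comp_linearIsometryEquiv, hy, Pi.zero_apply, Pi.zero_apply]

theorem analyticAt_of_harmonicAt_plane {f : Coord 2 → ℝ} {p : Coord 2} (hf : HarmonicAt f p) :
    AnalyticAt ℝ f p := by
  let L : ℂ ≃ₗᵢ[ℝ] Coord 2 := Complex.orthonormalBasisOneI.repr
  have h : AnalyticAt ℝ (f ∘ L) (L.symm p) :=
    HarmonicAt.analyticAt (harmonicAt_comp_linearIsometryEquiv L (by simpa using hf))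
  have h' : AnalyticAt ℝ ((f ∘ L) ∘ L.symm) p :=
    h.comp (L.symm.toContinuousLinearEquiv.toContinuousLinearMap.analyticAt p)
  simpa only [Function.comp_assoc, L.self_comp_symm, Function.comp_id] using h'

theorem sum_pderiv_pderiv_eq_laplacian {n : ℕ} {f : Coord n → ℝ} {p : Coord n}
    (hf : ContDiffAt ℝ 2 f p) : ∑ i, pderiv i (pderiv i f) p = Δ f p := by
  rw [laplacian_eq_iteratedFDeriv_orthonormalBasis f (EuclideanSpace.basisFun (Fin n) ℝ)]
  refine Finset.sum_congr rfl fun i _ => ?_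
  simp [pderiv_pderiv_eq_fderiv_fderiv hf, iteratedFDeriv_two_apply]

end Harmonic

local notation "δ" => (1 : Matrix (Fin _) (Fin _) ℝ)

section ConformallyFlat

/-- Near `p` the metric `g` is `f² (dx₁² + ⋯ + dxₙ²)`, with `f` of class `Cᵏ` and nonzero at `p`. -/
structure IsConformallyFlatAt {n : ℕ} (g : Coord n → Matrix (Fin n) (Fin n) ℝ) (f : Coord n → ℝ)
    (k : WithTop ℕ∞) (p : Coord n) : Prop where
  eventuallyEq : g =ᶠ[𝓝 p] fun q => f q ^ 2 • (1 : Matrix (Fin n) (Fin n) ℝ)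
  contDiffAt : ContDiffAt ℝ k f p
  ne_zero : f p ≠ 0

/-- The components of the Schouten tensor of the metric `f² (dx₁² + ⋯ + dxₙ²)`, whose
Kulkarni-Nomizu product with the metric is the curvature. The formula is taken as the definition in
every dimension, including `n = 2`, where the Ricci tensor does not determine it. -/
noncomputable def schouten {n : ℕ} (f : Coord n → ℝ) (i j : Fin n) (p : Coord n) : ℝ :=
  2 * (pderiv i f p / f p) * (pderiv j f p / f p) - pderiv i (pderiv j f) p / f p
    - (1 / 2) * (∑ e, (pderiv e f p / f p) ^ 2) * δ i j

variable {n : ℕ} {g : Coord n → Matrix (Fin n) (Fin n) ℝ} {f : Coord n → ℝ} {p : Coord n}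

theorem one_matrix_symm (i j : Fin n) : δ i j = δ j i := by
  rw [← Matrix.transpose_apply (1 : Matrix (Fin n) (Fin n) ℝ), Matrix.transpose_one]

theorem sum_one_matrix_mul (a : Fin n) (F : Fin n → ℝ) : ∑ e, δ a e * F e = F a := by
  simpa only [Matrix.mulVec, dotProduct] using congrFun (Matrix.one_mulVec F) a

theorem inv_sq_smul_one {c : ℝ} (hc : c ≠ 0) :
    (c ^ 2 • (1 : Matrix (Fin n) (Fin n) ℝ))⁻¹ = (c ^ 2)⁻¹ • 1 :=
  Matrix.inv_eq_right_inv (by simp [smul_smul, hc])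

namespace IsConformallyFlatAt

variable {k : WithTop ℕ∞}

theorem of_le {l : WithTop ℕ∞} (hg : IsConformallyFlatAt g f k p) (hl : l ≤ k) :
    IsConformallyFlatAt g f l p :=
  ⟨hg.eventuallyEq, hg.contDiffAt.of_le hl, hg.ne_zero⟩

theorem eventually (hg : IsConformallyFlatAt g f k p) (hk : k ≠ ∞) :
    ∀ᶠ q in 𝓝 p, IsConformallyFlatAt g f k q := by
  filter_upwards [hg.eventuallyEq.eventuallyEq_nhds, hg.contDiffAt.eventually hk,
    hg.contDiffAt.continuousAt.eventually_ne hg.ne_zero] with q h₁ h₂ h₃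
  exact ⟨h₁, h₂, h₃⟩

theorem differentiableAt (hg : IsConformallyFlatAt g f 1 p) : DifferentiableAt ℝ f p :=
  hg.contDiffAt.differentiableAt one_ne_zero

theorem inv_apply (hg : IsConformallyFlatAt g f k p) (i j : Fin n) :
    (g p)⁻¹ i j = (f p ^ 2)⁻¹ * δ i j := by
  rw [hg.eventuallyEq.self_of_nhds, inv_sq_smul_one hg.ne_zero, Matrix.smul_apply, smul_eq_mul]

theorem sum_inv_mul (hg : IsConformallyFlatAt g f k p) (M : Fin n → Fin n → ℝ) :
    ∑ i, ∑ j, (g p)⁻¹ i j * M i j = (f p ^ 2)⁻¹ * ∑ i, M i i := by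
  simp only [hg.inv_apply, mul_assoc, ← Finset.mul_sum, sum_one_matrix_mul]

theorem pderiv_metric (hg : IsConformallyFlatAt g f 1 p) (i j l : Fin n) :
    pderiv l (fun q => g q i j) p = 2 * f p * pderiv l f p * δ i j := by
  have h : (fun q => g q i j) =ᶠ[𝓝 p] fun q => δ i j * (f q * f q) := by
    filter_upwards [hg.eventuallyEq] with q hq
    rw [hq, Matrix.smul_apply, smul_eq_mul, sq, mul_comm]
  rw [pderiv_congr h, pderiv_const_mul _ (hg.differentiableAt.fun_mul hg.differentiableAt),
    pderiv_mul hg.differentiableAt hg.differentiableAt]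
  ring

theorem christoffel_eq (hg : IsConformallyFlatAt g f 1 p) (a i j : Fin n) :
    christoffel g a i j p = δ a j * (pderiv i f p / f p) + δ a i * (pderiv j f p / f p)
      - δ i j * (pderiv a f p / f p) := by
  simp only [christoffel, hg.pderiv_metric, hg.inv_apply, mul_assoc, ← Finset.mul_sum,
    sum_one_matrix_mul, one_matrix_symm j a, one_matrix_symm i a]
  field_simp [hg.ne_zero]

theorem pderiv_pderiv_div (hg : IsConformallyFlatAt g f 2 p) (i j : Fin n) :
    pderiv i (fun q => pderiv j f q / f q) p
      = pderiv i (pderiv j f) p / f p - pderiv i f p / f p * (pderiv j f p / f p) := by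
  rw [pderiv_div ((contDiffAt_pderiv hg.contDiffAt).differentiableAt one_ne_zero)
    (hg.contDiffAt.differentiableAt two_ne_zero) hg.ne_zero]
  field_simp [hg.ne_zero]

theorem pderiv_christoffel (hg : IsConformallyFlatAt g f 2 p) (l a i j : Fin n) :
    pderiv l (christoffel g a i j) p
      = δ a j * (pderiv l (pderiv i f) p / f p - pderiv l f p / f p * (pderiv i f p / f p))
      + δ a i * (pderiv l (pderiv j f) p / f p - pderiv l f p / f p * (pderiv j f p / f p))
      - δ i j * (pderiv l (pderiv a f) p / f p - pderiv l f p / f p * (pderiv a f p / f p)) := by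
  have hchr : christoffel g a i j =ᶠ[𝓝 p] fun q => δ a j * (pderiv i f q / f q)
      + δ a i * (pderiv j f q / f q) - δ i j * (pderiv a f q / f q) := by
    filter_upwards [hg.eventually (by decide)] with q hq
    exact (hq.of_le one_le_two).christoffel_eq a i j
  have hdiff (m : Fin n) : DifferentiableAt ℝ (fun q => pderiv m f q / f q) p :=
    differentiableAt_div ((contDiffAt_pderiv hg.contDiffAt).differentiableAt one_ne_zero)
      (hg.contDiffAt.differentiableAt two_ne_zero) hg.ne_zero
  rw [pderiv_congr hchr,
    pderiv_sub (((hdiff i).const_mul _).fun_add ((hdiff j).const_mul _)) ((hdiff a).const_mul _),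
    pderiv_add ((hdiff i).const_mul _) ((hdiff j).const_mul _), pderiv_const_mul _ (hdiff i),
    pderiv_const_mul _ (hdiff j), pderiv_const_mul _ (hdiff a)]
  simp only [hg.pderiv_pderiv_div]

theorem sum_christoffel_mul_christoffel (hg : IsConformallyFlatAt g f 1 p) (a b c d : Fin n) :
    ∑ e, christoffel g a b e p * christoffel g e c d p
      = pderiv b f p / f p * christoffel g a c d p - pderiv a f p / f p * christoffel g b c d p
        + δ a b * (2 * (pderiv c f p / f p) * (pderiv d f p / f p)
          - δ c d * ∑ e, (pderiv e f p / f p) ^ 2) := by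
  have hsum : ∑ e, pderiv e f p / f p * christoffel g e c d p
      = 2 * (pderiv c f p / f p) * (pderiv d f p / f p)
        - δ c d * ∑ e, (pderiv e f p / f p) ^ 2 := by
    calc ∑ e, pderiv e f p / f p * christoffel g e c d p
        = pderiv c f p / f p * ∑ e, δ d e * (pderiv e f p / f p)
          + pderiv d f p / f p * ∑ e, δ c e * (pderiv e f p / f p)
          - δ c d * ∑ e, (pderiv e f p / f p) ^ 2 := by
          simp only [hg.christoffel_eq, Finset.mul_sum, ← Finset.sum_add_distrib,
            ← Finset.sum_sub_distrib]
          exact Finset.sum_congr rfl fun e _ => by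
            rw [one_matrix_symm d e, one_matrix_symm c e]
            ring
      _ = _ := by
          rw [sum_one_matrix_mul, sum_one_matrix_mul]
          ring
  calc ∑ e, christoffel g a b e p * christoffel g e c d p
      = pderiv b f p / f p * ∑ e, δ a e * christoffel g e c d p
        - pderiv a f p / f p * ∑ e, δ b e * christoffel g e c d p
        + δ a b * ∑ e, pderiv e f p / f p * christoffel g e c d p := by
        simp only [hg.christoffel_eq a b, Finset.mul_sum, ← Finset.sum_add_distrib,
          ← Finset.sum_sub_distrib]
        exact Finset.sum_congr rfl fun e _ => by ring
    _ = _ := by rw [sum_one_matrix_mul, sum_one_matrix_mul, hsum]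

theorem curvature_eq (hg : IsConformallyFlatAt g f 2 p) (a b c d : Fin n) :
    curvature g a b c d p = δ a b * schouten f c d p - δ a c * schouten f b d p
      + δ c d * schouten f a b p - δ b d * schouten f a c p := by
  have hg₁ := hg.of_le one_le_two
  rw [curvature, Finset.sum_sub_distrib, hg₁.sum_christoffel_mul_christoffel,
    hg₁.sum_christoffel_mul_christoffel, hg.pderiv_christoffel, hg.pderiv_christoffel]
  simp only [hg₁.christoffel_eq, schouten, pderiv_comm hg.contDiffAt (i := c) (j := b),
    pderiv_comm hg.contDiffAt (i := a), one_matrix_symm c b]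
  ring

theorem sum_christoffel_self (hg : IsConformallyFlatAt g f 1 p) (a : Fin n) :
    ∑ i, christoffel g a i i p = (2 - n) * (pderiv a f p / f p) := by
  simp only [hg.christoffel_eq, Finset.sum_sub_distrib, Finset.sum_add_distrib,
    sum_one_matrix_mul, Matrix.one_apply_eq, one_mul, Finset.sum_const, Finset.card_univ,
    Fintype.card_fin, nsmul_eq_mul]
  ring

theorem sum_curvature_self (hg : IsConformallyFlatAt g f 2 p) (a c : Fin n) :
    ∑ i, curvature g a i c i p
      = (n - 2) * (pderiv a (pderiv c f) p / f p - 2 * (pderiv a f p / f p) * (pderiv c f p / f p))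
        + δ a c * ((∑ i, pderiv i (pderiv i f) p) / f p
          + (n - 3) * ∑ i, (pderiv i f p / f p) ^ 2) := by
  have htrace : ∑ i, schouten f i i p = (2 - n / 2) * ∑ i, (pderiv i f p / f p) ^ 2
      - (∑ i, pderiv i (pderiv i f) p) / f p := by
    simp only [schouten, Matrix.one_apply_eq, Finset.sum_sub_distrib, mul_one, Finset.sum_const,
      Finset.card_univ, Fintype.card_fin, nsmul_eq_mul, mul_assoc, ← Finset.mul_sum, ← sq,
      ← Finset.sum_div]
    ring
  simp only [hg.curvature_eq, Finset.sum_sub_distrib, Finset.sum_add_distrib, sum_one_matrix_mul,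
    Matrix.one_apply_eq, one_mul, Finset.sum_const, Finset.card_univ, Fintype.card_fin,
    nsmul_eq_mul, ← Finset.mul_sum, htrace]
  simp only [schouten, pderiv_comm hg.contDiffAt (i := c) (j := a), one_matrix_symm c a]
  ring

end IsConformallyFlatAt

end ConformallyFlat

section PullbackConnection

variable {m n : ℕ} {h : Coord n → Matrix (Fin n) (Fin n) ℝ} {φ : Coord m → Coord n}
  {V W : Coord m → Fin n → ℝ} {p : Coord m}

theorem pullbackCovDeriv_congr (hVW : V =ᶠ[𝓝 p] W) (i : Fin m) (a : Fin n) :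
    pullbackCovDeriv h φ V i p a = pullbackCovDeriv h φ W i p a := by
  have hVWa : (fun q => V q a) =ᶠ[𝓝 p] fun q => W q a := hVW.mono fun q hq => congrFun hq a
  simp only [pullbackCovDeriv, hVW.self_of_nhds, pderiv_congr hVWa]

theorem pullbackCovDeriv_add {a : Fin n} (hV : DifferentiableAt ℝ (fun q => V q a) p)
    (hW : DifferentiableAt ℝ (fun q => W q a) p) (i : Fin m) :
    pullbackCovDeriv h φ (V + W) i p a
      = pullbackCovDeriv h φ V i p a + pullbackCovDeriv h φ W i p a := by
  simp only [pullbackCovDeriv, Pi.add_apply, pderiv_add hV hW, mul_add, Finset.sum_add_distrib]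
  ring

end PullbackConnection

section Plane

theorem sum_castSucc_eq_sub (F : Fin 3 → ℝ) : ∑ i : Fin 2, F i.castSucc = ∑ i, F i - F 2 :=
  eq_sub_of_add_eq (Fin.sum_univ_castSucc F).symm

theorem sum_one_matrix_castSucc_mul (a : Fin 3) (F : Fin 3 → ℝ) :
    ∑ i : Fin 2, δ a i.castSucc * F i.castSucc = F a - δ a (2 : Fin 3) * F 2 := by
  rw [sum_castSucc_eq_sub fun i => δ a i * F i, sum_one_matrix_mul]

/-- The inclusion `planeInclusion` of the plane `z = 0`, as a continuous linear map. -/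
noncomputable def planeInclusionCLM : Coord 2 →L[ℝ] Coord 3 :=
  LinearMap.toContinuousLinearMap
    { toFun := planeInclusion
      map_add' := fun p q => by ext i; fin_cases i <;> simp [planeInclusion]
      map_smul' := fun c p => by ext i; fin_cases i <;> simp [planeInclusion] }

theorem contDiff_planeInclusion {k : WithTop ℕ∞} : ContDiff ℝ k planeInclusion :=
  planeInclusionCLM.contDiff

theorem fderiv_planeInclusion (p : Coord 2) : fderiv ℝ planeInclusion p = planeInclusionCLM :=
  planeInclusionCLM.fderiv

theorem planeInclusionCLM_single (i : Fin 2) :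
    planeInclusionCLM (EuclideanSpace.single i 1) = EuclideanSpace.single i.castSucc 1 := by
  change planeInclusion _ = _
  ext j
  fin_cases i <;> fin_cases j <;> simp [planeInclusion]

variable {p : Coord 2}

theorem pderiv_comp_planeInclusion {F : Coord 3 → ℝ}
    (hF : DifferentiableAt ℝ F (planeInclusion p)) (i : Fin 2) :
    pderiv i (fun q => F (planeInclusion q)) p = pderiv i.castSucc F (planeInclusion p) := by
  have h : HasFDerivAt (fun q => F (planeInclusion q))
      ((fderiv ℝ F (planeInclusion p)).comp planeInclusionCLM) p :=
    hF.hasFDerivAt.comp (f := planeInclusion) p planeInclusionCLM.hasFDerivAt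
  rw [pderiv, h.fderiv, ContinuousLinearMap.comp_apply, planeInclusionCLM_single, pderiv]

theorem differentiableAt_comp_planeInclusion {F : Coord 3 → ℝ}
    (hF : DifferentiableAt ℝ F (planeInclusion p)) :
    DifferentiableAt ℝ (fun q => F (planeInclusion q)) p :=
  hF.comp p planeInclusionCLM.differentiableAt

theorem pderiv_pderiv_comp_planeInclusion {F : Coord 3 → ℝ}
    (hF : ContDiffAt ℝ 2 F (planeInclusion p)) (i j : Fin 2) :
    pderiv i (pderiv j fun q => F (planeInclusion q)) p
      = pderiv i.castSucc (pderiv j.castSucc F) (planeInclusion p) := by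
  have hj : (pderiv j fun q => F (planeInclusion q))
      =ᶠ[𝓝 p] fun q => pderiv j.castSucc F (planeInclusion q) := by
    filter_upwards [planeInclusionCLM.continuous.continuousAt.eventually
      (hF.eventually (by decide))] with q hq
    exact pderiv_comp_planeInclusion (hq.differentiableAt two_ne_zero) j
  rw [pderiv_congr hj,
    pderiv_comp_planeInclusion ((contDiffAt_pderiv hF).differentiableAt one_ne_zero)]

theorem pderiv_planeInclusion (p : Coord 2) (i : Fin 2) (a : Fin 3) :
    pderiv i (fun q => planeInclusion q a) p = δ a i.castSucc := by
  rw [pderiv_comp_planeInclusion (F := fun q => q a) (by fun_prop), pderiv_coord,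
    Matrix.one_apply]

section SecondFundamentalForm

variable {h : Coord 3 → Matrix (Fin 3) (Fin 3) ℝ} {V : Coord 2 → Fin 3 → ℝ}

theorem pullbackCovDeriv_planeInclusion (i : Fin 2) (a : Fin 3) :
    pullbackCovDeriv h planeInclusion V i p a = pderiv i (fun q => V q a) p
      + ∑ c, christoffel h a i.castSucc c (planeInclusion p) * V p c := by
  have hsum (c : Fin 3) : ∑ b, christoffel h a b c (planeInclusion p)
      * pderiv i (fun q => planeInclusion q b) p * V p c
        = christoffel h a i.castSucc c (planeInclusion p) * V p c := by
    calc _ = ∑ b, δ i.castSucc b * (christoffel h a b c (planeInclusion p) * V p c) :=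
          Finset.sum_congr rfl fun b _ => by
            rw [pderiv_planeInclusion, one_matrix_symm b]
            ring
      _ = _ := sum_one_matrix_mul _ _
  rw [pullbackCovDeriv, Finset.sum_comm]
  simp only [hsum]

/-- The field `b ∂ₖ` along the plane `z = 0`. -/
def coordField (k : Fin 3) (b : Coord 2 → ℝ) (p : Coord 2) (c : Fin 3) : ℝ :=
  δ c k * b p

/-- The field `a ν` along the plane `z = 0`, where `ν = f⁻¹ ∂_z` is the unit normal of the plane in
the metric `f² (dx² + dy² + dz²)`. -/
noncomputable def normalField (f : Coord 3 → ℝ) (a : Coord 2 → ℝ) : Coord 2 → Fin 3 → ℝ :=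
  coordField 2 fun q => a q / f (planeInclusion q)

/-- The principal curvature `κ` of the plane `z = 0`, which is totally umbilical in the metric
`f² (dx² + dy² + dz²)`: it is normalized by `∇_X ν = κ X` with `ν = f⁻¹ ∂_z`. -/
noncomputable def planeCurvature (f : Coord 3 → ℝ) (p : Coord 2) : ℝ :=
  pderiv 2 f (planeInclusion p) / f (planeInclusion p) ^ 2

variable {f : Coord 3 → ℝ} {a b : Coord 2 → ℝ}

theorem differentiableAt_coordField (hb : DifferentiableAt ℝ b p)
    (k c : Fin 3) : DifferentiableAt ℝ (fun q => coordField k b q c) p :=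
  hb.const_mul _

theorem differentiableAt_normalField (hh : IsConformallyFlatAt h f 1 (planeInclusion p))
    (ha : DifferentiableAt ℝ a p) (c : Fin 3) :
    DifferentiableAt ℝ (fun q => normalField f a q c) p :=
  differentiableAt_coordField (differentiableAt_div ha
    (differentiableAt_comp_planeInclusion hh.differentiableAt) hh.ne_zero) 2 c

theorem pullbackCovDeriv_coordField {k : Fin 3} (hb : DifferentiableAt ℝ b p)
    (i : Fin 2) (c : Fin 3) :
    pullbackCovDeriv h planeInclusion (coordField k b) i p c
      = δ c k * pderiv i b p + christoffel h c i.castSucc k (planeInclusion p) * b p := by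
  rw [pullbackCovDeriv_planeInclusion]
  simp only [coordField, pderiv_const_mul _ hb, one_matrix_symm _ k, mul_left_comm _ (δ _ _),
    sum_one_matrix_mul]

theorem pullbackCovDeriv_normalField (hh : IsConformallyFlatAt h f 1 (planeInclusion p))
    (ha : DifferentiableAt ℝ a p) (i : Fin 2) :
    pullbackCovDeriv h planeInclusion (normalField f a) i p = normalField f (pderiv i a) p
      + coordField i.castSucc (fun q => a q * planeCurvature f q) p := by
  have hf := differentiableAt_comp_planeInclusion hh.differentiableAt
  have hi : δ i.castSucc (2 : Fin 3) = 0 := Matrix.one_apply_ne (Fin.castSucc_lt_last i).ne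
  funext c
  rw [normalField, pullbackCovDeriv_coordField (differentiableAt_div ha hf hh.ne_zero),
    pderiv_div ha hf hh.ne_zero, pderiv_comp_planeInclusion hh.differentiableAt,
    hh.christoffel_eq, hi]
  simp only [Pi.add_apply, normalField, coordField, planeCurvature]
  field_simp [hh.ne_zero]
  ring

theorem sum_pullbackCovDeriv_coordField (hh : IsConformallyFlatAt h f 1 (planeInclusion p))
    (hb : DifferentiableAt ℝ b p) (c : Fin 3) :
    ∑ i : Fin 2, pullbackCovDeriv h planeInclusion (coordField i.castSucc b) i p c
      = ∑ i : Fin 2, δ c i.castSucc * pderiv i b p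
        - 2 * δ c (2 : Fin 3) * (f (planeInclusion p) * planeCurvature f p) * b p := by
  simp only [pullbackCovDeriv_coordField hb, Finset.sum_add_distrib, ← Finset.sum_mul]
  rw [sum_castSucc_eq_sub fun i => christoffel h c i i (planeInclusion p),
    hh.sum_christoffel_self, hh.christoffel_eq, Matrix.one_apply_eq]
  simp only [planeCurvature]
  push_cast
  field_simp [hh.ne_zero]
  ring

theorem differentiableAt_planeCurvature (hh : IsConformallyFlatAt h f 2 (planeInclusion p)) :
    DifferentiableAt ℝ (planeCurvature f) p :=
  differentiableAt_div (differentiableAt_comp_planeInclusion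
      ((contDiffAt_pderiv hh.contDiffAt).differentiableAt one_ne_zero))
    ((differentiableAt_comp_planeInclusion
      (hh.contDiffAt.differentiableAt two_ne_zero)).fun_pow 2) (pow_ne_zero 2 hh.ne_zero)

theorem pderiv_planeCurvature (hh : IsConformallyFlatAt h f 2 (planeInclusion p)) (i : Fin 2) :
    f (planeInclusion p) * pderiv i (planeCurvature f) p
      = pderiv i.castSucc (pderiv 2 f) (planeInclusion p) / f (planeInclusion p)
        - 2 * (pderiv i.castSucc f (planeInclusion p) / f (planeInclusion p))
          * (pderiv 2 f (planeInclusion p) / f (planeInclusion p)) := by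
  have hf := hh.contDiffAt.differentiableAt two_ne_zero
  have hfz : DifferentiableAt ℝ (pderiv 2 f) (planeInclusion p) :=
    (contDiffAt_pderiv hh.contDiffAt).differentiableAt one_ne_zero
  have hf₂ : f (planeInclusion p) * f (planeInclusion p) ≠ 0 := mul_ne_zero hh.ne_zero hh.ne_zero
  have hdiv := differentiableAt_div hfz (hf.fun_mul hf) hf₂
  have hκ : planeCurvature f = fun q => pderiv 2 f (planeInclusion q)
      / (f (planeInclusion q) * f (planeInclusion q)) :=
    funext fun q => by rw [planeCurvature, sq]
  rw [hκ, pderiv_comp_planeInclusion (F := fun q => pderiv 2 f q / (f q * f q)) hdiv,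
    pderiv_div hfz (hf.fun_mul hf) hf₂, pderiv_mul hf hf]
  field_simp [hh.ne_zero]
  ring

theorem sum_pullbackCovDeriv_pullbackCovDeriv_normalField
    (hh : IsConformallyFlatAt h f 2 (planeInclusion p)) (ha : ContDiffAt ℝ 2 a p) (c : Fin 3) :
    ∑ i, pullbackCovDeriv h planeInclusion
        (fun q => pullbackCovDeriv h planeInclusion (normalField f a) i q) i p c
      = 2 * planeCurvature f p * ∑ i : Fin 2, δ c i.castSucc * pderiv i a p
        + a p * ∑ i : Fin 2, δ c i.castSucc * pderiv i (planeCurvature f) p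
        + δ c (2 : Fin 3) * ((∑ i, pderiv i (pderiv i a) p) / f (planeInclusion p)
          - 2 * a p * planeCurvature f p ^ 2 * f (planeInclusion p)) := by
  have hh₁ := hh.of_le one_le_two
  have hκ := differentiableAt_planeCurvature hh
  have ha₁ := ha.differentiableAt two_ne_zero
  have hda (i : Fin 2) : DifferentiableAt ℝ (pderiv i a) p :=
    (contDiffAt_pderiv ha).differentiableAt one_ne_zero
  have hnabla (i : Fin 2) : (fun q => pullbackCovDeriv h planeInclusion (normalField f a) i q)
      =ᶠ[𝓝 p] normalField f (pderiv i a)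
        + coordField i.castSucc (fun q => a q * planeCurvature f q) := by
    filter_upwards [planeInclusionCLM.continuous.continuousAt.eventually
      (hh.eventually (by decide)), ha.eventually (by decide)] with q hhq haq
    exact pullbackCovDeriv_normalField (hhq.of_le one_le_two) (haq.differentiableAt two_ne_zero) i
  have hsecond (i : Fin 2) : pullbackCovDeriv h planeInclusion
      (fun q => pullbackCovDeriv h planeInclusion (normalField f a) i q) i p c
      = δ c (2 : Fin 3) * (pderiv i (pderiv i a) p / f (planeInclusion p))
        + δ c i.castSucc * (planeCurvature f p * pderiv i a p)
        + pullbackCovDeriv h planeInclusion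
          (coordField i.castSucc fun q => a q * planeCurvature f q) i p c := by
    rw [pullbackCovDeriv_congr (hnabla i), pullbackCovDeriv_add
      (differentiableAt_normalField hh₁ (hda i) c)
      (differentiableAt_coordField (ha₁.fun_mul hκ) i.castSucc c),
      pullbackCovDeriv_normalField hh₁ (hda i)]
    simp only [Pi.add_apply, normalField, coordField, mul_comm (pderiv i a p)]
  simp only [hsecond, Finset.sum_add_distrib, sum_pullbackCovDeriv_coordField hh₁ (ha₁.fun_mul hκ),
    pderiv_mul ha₁ hκ, mul_add, mul_left_comm (δ _ _), ← Finset.mul_sum, ← Finset.sum_div]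
  ring

theorem sum_curvature_castSucc (hh : IsConformallyFlatAt h f 2 (planeInclusion p)) (c : Fin 3) :
    ∑ i : Fin 2, curvature h c i.castSucc 2 i.castSucc (planeInclusion p)
      = f (planeInclusion p) * ∑ i : Fin 2, δ c i.castSucc * pderiv i (planeCurvature f) p
        + δ c (2 : Fin 3) * ((∑ i, pderiv i (pderiv i f) (planeInclusion p)
            + pderiv 2 (pderiv 2 f) (planeInclusion p)) / f (planeInclusion p)
          - 2 * planeCurvature f p ^ 2 * f (planeInclusion p) ^ 2) := by
  have hsum := sum_one_matrix_castSucc_mul c fun b =>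
    pderiv b (pderiv 2 f) (planeInclusion p) / f (planeInclusion p)
      - 2 * (pderiv b f (planeInclusion p) / f (planeInclusion p))
        * (pderiv 2 f (planeInclusion p) / f (planeInclusion p))
  have hself : curvature h c 2 2 2 (planeInclusion p) = 0 := by
    rw [hh.curvature_eq]
    ring
  simp only [Finset.mul_sum, mul_left_comm (f (planeInclusion p)), pderiv_planeCurvature hh, hsum]
  rw [sum_castSucc_eq_sub fun i => curvature h c i 2 i (planeInclusion p), hself,
    hh.sum_curvature_self, planeCurvature]
  field_simp [hh.ne_zero]
  push_cast
  ring

end SecondFundamentalForm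

section Tension

variable {g : Coord 2 → Matrix (Fin 2) (Fin 2) ℝ} {u : Coord 2 → ℝ}
  {h : Coord 3 → Matrix (Fin 3) (Fin 3) ℝ} {f : Coord 3 → ℝ} {a : Coord 2 → ℝ}

/-- In dimension two the Laplacian on functions, hence on sections, is conformally covariant: the
trace of the Christoffel symbols vanishes. -/
theorem sum_inv_mul_sub_christoffel (hg : IsConformallyFlatAt g u 1 p) (M : Fin 2 → Fin 2 → ℝ)
    (X : Fin 2 → ℝ) :
    ∑ i, ∑ j, (g p)⁻¹ i j * (M i j - ∑ k, christoffel g k i j p * X k)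
      = (u p ^ 2)⁻¹ * ∑ i, M i i := by
  have htrace : ∑ i, ∑ k, christoffel g k i i p * X k = 0 := by
    rw [Finset.sum_comm]
    simp [← Finset.sum_mul, hg.sum_christoffel_self]
  rw [hg.sum_inv_mul, Finset.sum_sub_distrib, htrace, sub_zero]

theorem tensionField_planeInclusion (hg : IsConformallyFlatAt g u 1 p)
    (hh : IsConformallyFlatAt h f 1 (planeInclusion p)) :
    tensionField g h planeInclusion p
      = normalField f (fun q => -2 * pderiv 2 f (planeInclusion q) / u q ^ 2) p := by
  have hframe (j : Fin 2) : (fun q b => pderiv j (fun r => planeInclusion r b) q)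
      = coordField j.castSucc fun _ => 1 := by
    funext q b
    rw [pderiv_planeInclusion, coordField, mul_one]
  funext c
  simp only [tensionField, hframe]
  rw [sum_inv_mul_sub_christoffel hg,
    sum_pullbackCovDeriv_coordField hh (differentiableAt_const 1), normalField, coordField]
  simp only [pderiv_const, planeCurvature, mul_zero, Finset.sum_const_zero]
  field_simp [hh.ne_zero, hg.ne_zero]
  ring

theorem bitensionField_planeInclusion (hg : IsConformallyFlatAt g u 1 p)
    (hh : IsConformallyFlatAt h f 2 (planeInclusion p))
    (hτ : tensionField g h planeInclusion =ᶠ[𝓝 p] normalField f a) (ha : ContDiffAt ℝ 2 a p)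
    (c : Fin 3) :
    bitensionField g h planeInclusion p c
      = (u p ^ 2)⁻¹ * (2 * planeCurvature f p * ∑ i : Fin 2, δ c i.castSucc * pderiv i a p
        + δ c (2 : Fin 3) * ((∑ i, pderiv i (pderiv i a) p) / f (planeInclusion p)
          - a p / f (planeInclusion p) ^ 2 * (∑ i, pderiv i (pderiv i f) (planeInclusion p)
            + pderiv 2 (pderiv 2 f) (planeInclusion p)))) := by
  have hnabla (i : Fin 2) :
      (fun q => pullbackCovDeriv h planeInclusion (tensionField g h planeInclusion) i q)
        =ᶠ[𝓝 p] fun q => pullbackCovDeriv h planeInclusion (normalField f a) i q := by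
    filter_upwards [hτ.eventuallyEq_nhds] with q hq
    exact funext fun b => pullbackCovDeriv_congr hq i b
  have hcurv : ∑ i, ∑ j, (g p)⁻¹ i j * ∑ b, ∑ e, ∑ d, curvature h c b e d (planeInclusion p)
        * pderiv i (fun q => planeInclusion q b) p * tensionField g h planeInclusion p e
        * pderiv j (fun q => planeInclusion q d) p
      = (u p ^ 2)⁻¹ * ((a p / f (planeInclusion p)) *
        ∑ i : Fin 2, curvature h c i.castSucc 2 i.castSucc (planeInclusion p)) := by
    rw [hg.sum_inv_mul, Finset.mul_sum _ _ (a p / f (planeInclusion p))]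
    simp only [hτ.self_of_nhds, normalField, coordField, pderiv_planeInclusion]
    refine congrArg ((u p ^ 2)⁻¹ * ·) (Finset.sum_congr rfl fun i _ => ?_)
    simp only [Matrix.one_apply, mul_ite, ite_mul, mul_one, one_mul, mul_zero, zero_mul,
      Finset.sum_ite_eq', Finset.mem_univ, if_true]
    ring
  simp only [bitensionField]
  rw [hcurv, sum_inv_mul_sub_christoffel hg]
  simp only [pullbackCovDeriv_congr (hnabla _)]
  rw [sum_pullbackCovDeriv_pullbackCovDeriv_normalField hh ha, sum_curvature_castSucc hh]
  field_simp [hh.ne_zero, hg.ne_zero]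
  ring

theorem isProperBiharmonicMapOn_planeInclusion {U : Set (Coord 2)} (hU : IsOpen U)
    (hne : U.Nonempty) {c : ℝ} (hc : c ≠ 0) (hg : ∀ p ∈ U, IsConformallyFlatAt g u 1 p)
    (hh : ∀ p ∈ U, IsConformallyFlatAt h f 2 (planeInclusion p))
    (hfz : ∀ p ∈ U, pderiv 2 f (planeInclusion p) = -(c / 2) * u p ^ 2)
    (hfzz : ∀ p ∈ U, ∑ i, pderiv i (pderiv i f) (planeInclusion p)
      + pderiv 2 (pderiv 2 f) (planeInclusion p) = 0) :
    IsProperBiharmonicMapOn g h planeInclusion U := by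
  have hτ (p) (hp : p ∈ U) : tensionField g h planeInclusion p = normalField f (fun _ => c) p := by
    have hu := (hg p hp).ne_zero
    rw [tensionField_planeInclusion (hg p hp) ((hh p hp).of_le one_le_two)]
    funext b
    simp only [normalField, coordField, hfz p hp]
    field_simp
  refine ⟨fun p hp => funext fun b => ?_, fun hharm => ?_⟩
  · have hconst (i : Fin 2) : pderiv i (fun _ : Coord 2 => c) = fun _ => 0 :=
      funext fun _ => pderiv_const c
    rw [bitensionField_planeInclusion (hg p hp) (hh p hp)
      ((hU.eventually_mem hp).mono hτ) contDiffAt_const, hfzz p hp]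
    simp [hconst, pderiv_const]
  · obtain ⟨p, hp⟩ := hne
    have hz := congrFun ((hτ p hp).symm.trans (hharm p hp)) 2
    simp [normalField, coordField, hc, (hh p hp).ne_zero] at hz

end Tension

end Plane

section ConformalMetrics

theorem isRiemannianMetricOn_of_isConformallyFlatAt {n : ℕ}
    {g : Coord n → Matrix (Fin n) (Fin n) ℝ} {f : Coord n → ℝ} {V : Set (Coord n)}
    (hg : ∀ p ∈ V, IsConformallyFlatAt g f ∞ p) : IsRiemannianMetricOn g V where
  smooth i j p hp := by
    have hsmul : ContDiffAt ℝ ∞ (fun q => f q ^ 2 * δ i j) p :=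
      ((hg p hp).contDiffAt.pow 2).mul contDiffAt_const
    refine (hsmul.congr_of_eventuallyEq ?_).contDiffWithinAt
    filter_upwards [(hg p hp).eventuallyEq] with q hq
    rw [hq, Matrix.smul_apply, smul_eq_mul]
  posDef p hp := by
    rw [(hg p hp).eventuallyEq.self_of_nhds]
    exact Matrix.PosDef.one.smul (by have := (hg p hp).ne_zero; positivity)

theorem pullbackMetric_planeInclusion {h : Coord 3 → Matrix (Fin 3) (Fin 3) ℝ} {p : Coord 2}
    {c : ℝ} (hh : h (planeInclusion p) = c • 1) : pullbackMetric h planeInclusion p = c • 1 := by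
  ext i j
  simp only [pullbackMetric, hh, pderiv_planeInclusion, Matrix.of_apply, Matrix.smul_apply,
    smul_eq_mul, Matrix.one_apply, mul_ite, mul_one, mul_zero, Finset.sum_ite_eq',
    Finset.mem_univ, if_true, Fin.castSucc_inj]

theorem planeInclusion_injective : Function.Injective planeInclusion := by
  intro p q hpq
  ext i
  fin_cases i
  · exact congrArg (fun r : Coord 3 => r 0) hpq
  · exact congrArg (fun r : Coord 3 => r 1) hpq

end ConformalMetrics

section Profile

/-- The function of `s = ρ²` and the height `t = z` by which `w` exceeds the conformal factor
`2 / ((ρ² - z²) β)` of `β⁻² h₀` relative to `dx² + dy² + dz²`. -/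
noncomputable def verticalProfile (s t : ℝ) : ℝ :=
  2 * t / (s * (s - t ^ 2)) + 2 / √s ^ 3 * Real.arctan (t / √s)

theorem verticalProfile_zero (s : ℝ) : verticalProfile s 0 = 0 := by
  simp [verticalProfile]

theorem verticalProfile_neg (s t : ℝ) : verticalProfile s (-t) = -verticalProfile s t := by
  simp only [verticalProfile, neg_sq, neg_div, mul_neg, Real.arctan_neg]
  ring

theorem hasDerivAt_verticalProfile_zero {s : ℝ} (hs : 0 < s) :
    HasDerivAt (verticalProfile s) (4 / s ^ 2) 0 := by
  have hid := hasDerivAt_id (0 : ℝ)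
  have hrat := (hid.const_mul 2).fun_div (((hid.fun_pow 2).const_sub s).const_mul s)
    (by simp [hs.ne'])
  have hatan := ((hid.div_const √s).arctan).const_mul (2 / √s ^ 3)
  refine (hrat.add hatan).congr_deriv ?_
  have hsq : √s ^ 4 = s ^ 2 := by rw [pow_mul √s 2 2, Real.sq_sqrt hs.le]
  have hs₀ := hs.ne'
  have hr₀ := (Real.sqrt_pos.2 hs).ne'
  simp only [id_eq, zero_div, ne_eq, OfNat.ofNat_ne_zero, not_false_eq_true, zero_pow, mul_zero,
    zero_mul, sub_zero, add_zero, mul_one, div_one]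
  field_simp
  rw [hsq]
  ring

end Profile

section HyperbolicSpace

/-- The function `ρ² = 1 - x² - y²` on the ball. -/
def rhoSq (p : Coord 3) : ℝ := 1 - p 0 ^ 2 - p 1 ^ 2

/-- The function `f` with `β⁻² h₀ = f² (dx² + dy² + dz²)` over the domain of `w`. -/
noncomputable def spaceFactor (w : Coord 2 → ℝ) (p : Coord 3) : ℝ :=
  w !₂[p 0, p 1] - verticalProfile (rhoSq p) (p 2)

/-- The part of the unit ball that projects to `U`. -/
def ballOver (U : Set (Coord 2)) : Set (Coord 3) :=
  {p | p ∈ Metric.ball (0 : Coord 3) 1 ∧ !₂[p 0, p 1] ∈ U}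

variable {U : Set (Coord 2)} {w : Coord 2 → ℝ}

theorem contDiff_planeProjection {k : WithTop ℕ∞} :
    ContDiff ℝ k fun p : Coord 3 => (!₂[p 0, p 1] : Coord 2) := by
  rw [contDiff_euclidean]
  intro i
  fin_cases i
  · exact contDiff_piLp_apply 2
  · exact contDiff_piLp_apply 2

theorem isOpen_ballOver (hU : IsOpen U) : IsOpen (ballOver U) :=
  Metric.isOpen_ball.inter (hU.preimage (contDiff_planeProjection (k := 0)).continuous)

section BallOver

variable {p : Coord 3}

theorem one_sub_norm_sq (p : Coord 3) : 1 - ‖p‖ ^ 2 = rhoSq p - p 2 ^ 2 := by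
  rw [EuclideanSpace.real_norm_sq_eq, Fin.sum_univ_three, rhoSq]
  ring

theorem sq_lt_rhoSq (hp : p ∈ ballOver U) : p 2 ^ 2 < rhoSq p := by
  have hnorm : ‖p‖ ^ 2 < 1 := (sq_lt_one_iff₀ (norm_nonneg p)).2 (mem_ball_zero_iff.1 hp.1)
  linarith [one_sub_norm_sq p]

theorem rhoSq_pos (hp : p ∈ ballOver U) : 0 < rhoSq p :=
  (sq_nonneg _).trans_lt (sq_lt_rhoSq hp)

theorem betaFn_eq (hp : p ∈ ballOver U) :
    betaFn w p = 2 / ((rhoSq p - p 2 ^ 2) * spaceFactor w p) := by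
  have hr : 0 < √(rhoSq p) := Real.sqrt_pos.2 (rhoSq_pos hp)
  have hr_sq : √(rhoSq p) ^ 2 = rhoSq p := Real.sq_sqrt (rhoSq_pos hp).le
  have hden : √(rhoSq p) ^ 2 - p 2 ^ 2 ≠ 0 := by
    rw [hr_sq]
    exact (sub_pos.2 (sq_lt_rhoSq hp)).ne'
  have hrho : rhoFn (p 0) (p 1) = √(rhoSq p) := rfl
  rw [betaFn, hrho, ← mul_div_mul_left 2 _ (pow_ne_zero 3 hr.ne'), spaceFactor, verticalProfile]
  congr 1
  · ring
  · set r := √(rhoSq p)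
    rw [← hr_sq]
    field_simp
    ring

theorem conformalHyperbolicMetric_eq (hp : p ∈ ballOver U) :
    conformalHyperbolicMetric w p = spaceFactor w p ^ 2 • 1 := by
  have hden := (sub_pos.2 (sq_lt_rhoSq hp)).ne'
  rw [conformalHyperbolicMetric, hyperbolicMetric, betaFn_eq hp, one_sub_norm_sq, smul_smul]
  congr 1
  rcases eq_or_ne (spaceFactor w p) 0 with hf | hf
  · simp [hf]
  · field_simp
    norm_num

theorem betaDomain_eq : betaDomain U w = ballOver U ∩ spaceFactor w ⁻¹' Set.Ioi 0 := by
  have hβ {p : Coord 3} (hp : p ∈ ballOver U) : 0 < betaFn w p ↔ 0 < spaceFactor w p := by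
    rw [betaFn_eq hp, div_pos_iff_of_pos_left two_pos,
      mul_pos_iff_of_pos_left (sub_pos.2 (sq_lt_rhoSq hp))]
  exact Set.ext fun p => ⟨fun hp => ⟨⟨hp.1, hp.2.1⟩, (hβ ⟨hp.1, hp.2.1⟩).1 hp.2.2⟩,
    fun hp => ⟨hp.1.1, hp.1.2, (hβ hp.1).2 hp.2⟩⟩

theorem contDiffAt_spaceFactor (hw : HarmonicOnNhd w U) (hp : p ∈ ballOver U) :
    ContDiffAt ℝ ∞ (spaceFactor w) p := by
  have hs : ContDiffAt ℝ ∞ rhoSq p := by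
    unfold rhoSq
    fun_prop
  have hz : ContDiffAt ℝ ∞ (fun q : Coord 3 => q 2) p := by fun_prop
  have hr : ContDiffAt ℝ ∞ (fun q => √(rhoSq q)) p := hs.sqrt (rhoSq_pos hp).ne'
  have hr₀ : √(rhoSq p) ≠ 0 := (Real.sqrt_pos.2 (rhoSq_pos hp)).ne'
  have hproj : ContDiffAt ℝ ∞ (fun q : Coord 3 => w !₂[q 0, q 1]) p :=
    ContDiffAt.comp (g := w) p (analyticAt_of_harmonicAt_plane (hw _ hp.2)).contDiffAt
      contDiff_planeProjection.contDiffAt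
  have hrat := ((contDiffAt_const (c := (2 : ℝ))).mul hz).div (hs.mul (hs.sub (hz.pow 2)))
    (mul_ne_zero (rhoSq_pos hp).ne' (sub_pos.2 (sq_lt_rhoSq hp)).ne')
  have hatan := ((contDiffAt_const (c := (2 : ℝ))).div (hr.pow 3) (pow_ne_zero 3 hr₀)).mul
    (Real.contDiff_arctan.contDiffAt.comp p (hz.div hr hr₀))
  exact hproj.sub (hrat.add hatan)

theorem isConformallyFlatAt_conformalHyperbolicMetric (hU : IsOpen U) (hw : HarmonicOnNhd w U)
    (hp : p ∈ ballOver U) (hf : spaceFactor w p ≠ 0) :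
    IsConformallyFlatAt (conformalHyperbolicMetric w) (spaceFactor w) ∞ p where
  eventuallyEq := by
    filter_upwards [(isOpen_ballOver hU).mem_nhds hp] with q hq
    exact conformalHyperbolicMetric_eq hq
  contDiffAt := contDiffAt_spaceFactor hw hp
  ne_zero := hf

theorem isOpen_betaDomain (hU : IsOpen U) (hw : HarmonicOnNhd w U) :
    IsOpen (betaDomain U w) := by
  rw [betaDomain_eq]
  exact ContinuousOn.isOpen_inter_preimage
    (fun p hp => (contDiffAt_spaceFactor hw hp).continuousAt.continuousWithinAt)
    (isOpen_ballOver hU) isOpen_Ioi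

theorem isRiemannianMetricOn_conformalHyperbolicMetric (hU : IsOpen U) (hw : HarmonicOnNhd w U) :
    IsRiemannianMetricOn (conformalHyperbolicMetric w) (betaDomain U w) := by
  rw [betaDomain_eq]
  exact isRiemannianMetricOn_of_isConformallyFlatAt fun p hp =>
    isConformallyFlatAt_conformalHyperbolicMetric hU hw hp.1 hp.2.ne'

theorem spaceFactor_add_smul_single (w : Coord 2 → ℝ) (p : Coord 3) (t : ℝ) :
    spaceFactor w (p + t • EuclideanSpace.single 2 1)
      = w !₂[p 0, p 1] - verticalProfile (rhoSq p) (p 2 + t) := by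
  simp [spaceFactor, rhoSq]

end BallOver

section Restriction

variable {q : Coord 2}

theorem planeProjection_planeInclusion (q : Coord 2) :
    (!₂[planeInclusion q 0, planeInclusion q 1] : Coord 2) = q := by
  ext i
  fin_cases i <;> rfl

theorem spaceFactor_planeInclusion (w : Coord 2 → ℝ) (q : Coord 2) :
    spaceFactor w (planeInclusion q) = w q := by
  have hz : planeInclusion q 2 = 0 := rfl
  rw [spaceFactor, planeProjection_planeInclusion, hz, verticalProfile_zero, sub_zero]

theorem norm_planeInclusion (q : Coord 2) : ‖planeInclusion q‖ = ‖q‖ := by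
  simp [EuclideanSpace.norm_eq, Fin.sum_univ_three, Fin.sum_univ_two, planeInclusion]

theorem planeInclusion_mem_ballOver (hU : U ⊆ Metric.ball (0 : Coord 2) 1) (hq : q ∈ U) :
    planeInclusion q ∈ ballOver U := by
  refine ⟨?_, by rwa [planeProjection_planeInclusion]⟩
  rw [mem_ball_zero_iff, norm_planeInclusion]
  exact mem_ball_zero_iff.1 (hU hq)

theorem pderiv_two_spaceFactor_planeInclusion (hU : U ⊆ Metric.ball (0 : Coord 2) 1)
    (hw : HarmonicOnNhd w U) (hq : q ∈ U) :
    pderiv 2 (spaceFactor w) (planeInclusion q) = -(4 / (1 - q 0 ^ 2 - q 1 ^ 2) ^ 2) := by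
  have hp := planeInclusion_mem_ballOver hU hq
  have hline := hasDerivAt_line_zero (i := 2)
    ((contDiffAt_spaceFactor hw hp).differentiableAt (by simp))
  have hz : planeInclusion q 2 = 0 := rfl
  simp only [spaceFactor_add_smul_single, hz, zero_add] at hline
  exact hline.unique ((hasDerivAt_verticalProfile_zero (rhoSq_pos hp)).const_sub _)

theorem pderiv_two_pderiv_two_spaceFactor_planeInclusion (hU : U ⊆ Metric.ball (0 : Coord 2) 1)
    (hw : HarmonicOnNhd w U) (hq : q ∈ U) :
    pderiv 2 (pderiv 2 (spaceFactor w)) (planeInclusion q) = 0 := by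
  have hz : planeInclusion q 2 = 0 := rfl
  refine pderiv_pderiv_eq_zero_of_odd
    ((contDiffAt_spaceFactor hw (planeInclusion_mem_ballOver hU hq)).of_le ENat.LEInfty.out)
    fun t => ?_
  simp only [spaceFactor_add_smul_single, spaceFactor_planeInclusion,
    planeProjection_planeInclusion, hz, zero_add, verticalProfile_neg]
  ring

theorem sum_pderiv_pderiv_castSucc_spaceFactor_planeInclusion
    (hU : U ⊆ Metric.ball (0 : Coord 2) 1) (hw : HarmonicOnNhd w U) (hq : q ∈ U) :
    ∑ i : Fin 2, pderiv i.castSucc (pderiv i.castSucc (spaceFactor w)) (planeInclusion q) = 0 := by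
  have hf : ContDiffAt ℝ 2 (spaceFactor w) (planeInclusion q) :=
    (contDiffAt_spaceFactor hw (planeInclusion_mem_ballOver hU hq)).of_le ENat.LEInfty.out
  simp only [← pderiv_pderiv_comp_planeInclusion hf, spaceFactor_planeInclusion]
  rw [sum_pderiv_pderiv_eq_laplacian (hw q hq).1, (hw q hq).2.self_of_nhds, Pi.zero_apply]

theorem one_sub_sq_sub_sq_pos (hU : U ⊆ Metric.ball (0 : Coord 2) 1) (hq : q ∈ U) :
    0 < 1 - q 0 ^ 2 - q 1 ^ 2 :=
  rhoSq_pos (planeInclusion_mem_ballOver hU hq)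

theorem isConformallyFlatAt_hyperbolicMetric_two (hU : U ⊆ Metric.ball (0 : Coord 2) 1)
    (hq : q ∈ U) :
    IsConformallyFlatAt (hyperbolicMetric 2) (fun r => 2 / (1 - r 0 ^ 2 - r 1 ^ 2)) ∞ q where
  eventuallyEq := Eventually.of_forall fun r => by
    have hnorm : 1 - ‖r‖ ^ 2 = 1 - r 0 ^ 2 - r 1 ^ 2 := by
      rw [EuclideanSpace.real_norm_sq_eq, Fin.sum_univ_two]
      ring
    beta_reduce
    rw [hyperbolicMetric, hnorm, div_pow]
    norm_num
  contDiffAt := contDiffAt_const.div (by fun_prop) (one_sub_sq_sub_sq_pos hU hq).ne'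
  ne_zero := (div_pos two_pos (one_sub_sq_sub_sq_pos hU hq)).ne'

theorem isConformallyFlatAt_conformalHyperbolicMetric_planeInclusion (hUopen : IsOpen U)
    (hU : U ⊆ Metric.ball (0 : Coord 2) 1) (hw : HarmonicOnNhd w U) (hq : q ∈ U) (hwq : w q ≠ 0) :
    IsConformallyFlatAt (conformalHyperbolicMetric w) (spaceFactor w) ∞ (planeInclusion q) :=
  isConformallyFlatAt_conformalHyperbolicMetric hUopen hw (planeInclusion_mem_ballOver hU hq)
    (by rwa [spaceFactor_planeInclusion])

theorem isConformalImmersionOn_planeInclusion (hU : U ⊆ Metric.ball (0 : Coord 2) 1)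
    (hwpos : ∀ p ∈ U, 0 < w p) :
    IsConformalImmersionOn (hyperbolicMetric 2) (conformalHyperbolicMetric w) planeInclusion
      U (betaDomain U w) (fun p => w p * (1 - p 0 ^ 2 - p 1 ^ 2) / 2) where
  mapsTo p hp := by
    rw [betaDomain_eq]
    refine ⟨planeInclusion_mem_ballOver hU hp, ?_⟩
    rw [Set.mem_preimage, spaceFactor_planeInclusion]
    exact hwpos p hp
  smooth := contDiff_planeInclusion.contDiffOn
  immersion p _ := by
    rw [fderiv_planeInclusion]
    exact planeInclusion_injective
  factor_pos p hp := div_pos (mul_pos (hwpos p hp) (one_sub_sq_sub_sq_pos hU hp)) two_pos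
  conformal p hp := by
    have hpos := (one_sub_sq_sub_sq_pos hU hp).ne'
    rw [pullbackMetric_planeInclusion
        (conformalHyperbolicMetric_eq (planeInclusion_mem_ballOver hU hp)),
      (isConformallyFlatAt_hyperbolicMetric_two hU hp).eventuallyEq.self_of_nhds,
      spaceFactor_planeInclusion, smul_smul]
    congr 1
    field_simp

theorem isProperBiharmonicMapOn_conformalHyperbolicMetric (hUopen : IsOpen U) (hne : U.Nonempty)
    (hU : U ⊆ Metric.ball (0 : Coord 2) 1) (hw : HarmonicOnNhd w U) (hw₀ : ∀ p ∈ U, w p ≠ 0) :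
    IsProperBiharmonicMapOn (hyperbolicMetric 2) (conformalHyperbolicMetric w) planeInclusion
      U := by
  refine isProperBiharmonicMapOn_planeInclusion hUopen hne two_ne_zero
    (fun p hp => (isConformallyFlatAt_hyperbolicMetric_two hU hp).of_le ENat.LEInfty.out)
    (fun p hp => (isConformallyFlatAt_conformalHyperbolicMetric_planeInclusion hUopen hU hw hp
      (hw₀ p hp)).of_le ENat.LEInfty.out) (fun p hp => ?_) fun p hp => ?_
  · rw [pderiv_two_spaceFactor_planeInclusion hU hw hp, div_pow]
    ring
  · have htangential := sum_pderiv_pderiv_castSucc_spaceFactor_planeInclusion hU hw hp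
    rw [sum_castSucc_eq_sub fun i => pderiv i (pderiv i (spaceFactor w)) (planeInclusion p),
      sub_eq_zero] at htangential
    rw [htangential, pderiv_two_pderiv_two_spaceFactor_planeInclusion hU hw hp, add_zero]

end Restriction

end HyperbolicSpace

theorem mainTheorem9
    (U : Set (Coord 2)) (hUopen : IsOpen U) (hUne : U.Nonempty)
    (hUdisk : U ⊆ Metric.ball (0 : Coord 2) 1)
    (w : Coord 2 → ℝ) (hw : InnerProductSpace.HarmonicOnNhd w U) (hwpos : ∀ p ∈ U, 0 < w p) :
    IsRiemannianMetricOn (hyperbolicMetric 2) U ∧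
    IsOpen (betaDomain U w) ∧
    IsRiemannianMetricOn (conformalHyperbolicMetric w) (betaDomain U w) ∧
    IsConformalImmersionOn (hyperbolicMetric 2) (conformalHyperbolicMetric w) planeInclusion
      U (betaDomain U w) (fun p => w p * (1 - p 0 ^ 2 - p 1 ^ 2) / 2) ∧
    IsProperBiharmonicMapOn (hyperbolicMetric 2) (conformalHyperbolicMetric w) planeInclusion U :=
  ⟨isRiemannianMetricOn_of_isConformallyFlatAt fun _ hp =>
      isConformallyFlatAt_hyperbolicMetric_two hUdisk hp,
    isOpen_betaDomain hUopen hw,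
    isRiemannianMetricOn_conformalHyperbolicMetric hUopen hw,
    isConformalImmersionOn_planeInclusion hUdisk hwpos,
    isProperBiharmonicMapOn_conformalHyperbolicMetric hUopen hUne hUdisk hw fun p hp =>
      (hwpos p hp).ne'⟩
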